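/- All actions are left monoidal actions (the identity acts as the identity map), homomorphisms of monoids preserve the identity, and an embedding of topological monoids is a monoid homomorphism that is a topological embedding. A Stone space is a compact Hausdorff space with a basis of clopen sets. For a compact space $Y$, $C(Y,Y)$ denotes the topological monoid of all continuous maps $Y\to Y$ with composition and the compact-open topology; it acts on $Y$ by evaluation. A topological monoid $S$ is left non-archimedean (l-NA) if there are a Stone space $Y$ with a continuous action $S\times Y\to Y$ and a topological embedding $\nu\colon S\to Y$ with dense image such that $\nu(st)=s\,\nu(t)$ for all $s,t\in S$. Theorem. (1) $C(2^{\omega},2^{\omega})$ is a Polish l-NA monoid, and it is universal for separable metrizable l-NA monoids: every separable metrizable l-NA monoid $S$ admits an embedding of topological monoids $S\hookrightarrow C(2^{\omega},2^{\omega})$. (2) The evaluation action of $C(2^{\omega},2^{\omega})$ on the metrizable Stone space $2^{\omega}$ is continuous, and it is universal in the class of all actions $S\times Y\to Y$ where $Y$ is a metrizable Stone space and $S$ is a topological submonoid of $C(Y,Y)$ (a submonoid with the subspace topology, acting by evaluation): for every such $Y$ and $S$ there are an embedding of topological monoids $h\colon S\hookrightarrow C(2^{\omega},2^{\omega})$ and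 a topological embedding $\alpha\colon Y\hookrightarrow 2^{\omega}$ with $\alpha(s(y))=h(s)(\alpha(y))$ for all $s\in S$, $y\in Y$. -/

import Mathlib

open Topology TopologicalSpace

universe u v w

/-- A Stone space: a compact Hausdorff space with a basis of clopen sets. -/
structure IsStoneSpace (Y : Type u) [TopologicalSpace Y] : Prop where
  compact : CompactSpace Y
  t2 : T2Space Y
  clopen_basis : IsTopologicalBasis {U : Set Y | IsClopen U}

/-- The monoid `C(Y, Y)` of all continuous selfmaps of `Y`. A synonym of `C(Y, Y)`, so that its
multiplication is composition and cannot be confused with a pointwise multiplication. -/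
def SelfMaps (Y : Type u) [TopologicalSpace Y] : Type u := C(Y, Y)

namespace SelfMaps

variable {Y : Type u} [TopologicalSpace Y]

/-- The compact-open topology. -/
instance : TopologicalSpace (SelfMaps Y) :=
  inferInstanceAs (TopologicalSpace C(Y, Y))

/-- Composition of maps: `f * g = f ∘ g`. -/
instance : Monoid (SelfMaps Y) where
  mul f g := ContinuousMap.comp f g
  one := ContinuousMap.id Y
  mul_assoc _ _ _ := rfl
  one_mul _ := rfl
  mul_one _ := rfl

/-- The evaluation action of `C(Y, Y)` on `Y`: `f • y = f y`. -/
instance : MulAction (SelfMaps Y) Y where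
  smul f y := ContinuousMap.toFun f y
  one_smul _ := rfl
  mul_smul _ _ _ := rfl

/-- For locally compact (in particular compact) `Y`, composition is jointly continuous. -/
instance [LocallyCompactPair Y Y] : ContinuousMul (SelfMaps Y) where
  continuous_mul :=
    (ContinuousMap.continuous_comp' (X := Y) (Y := Y) (Z := Y)).comp continuous_swap

end SelfMaps

/-- The continuous action of the topological monoid `S` on `X` is non-archimedean: there is a
proper `S`-compactification `ν : X → Y` (a dense equivariant topological embedding into a compact
`S`-space) with `Y` a Stone space. -/
def IsNonarchimedeanAction (S : Type u) (X : Type w) [Monoid S] [TopologicalSpace S]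
    [ContinuousMul S] [TopologicalSpace X] [MulAction S X] [ContinuousSMul S X] : Prop :=
  ∃ (Y : Type v) (_ : TopologicalSpace Y) (_ : MulAction S Y) (ν : X → Y),
    IsStoneSpace Y ∧ ContinuousSMul S Y ∧ IsEmbedding ν ∧ DenseRange ν ∧
      ∀ (s : S) (x : X), ν (s • x) = s • ν x

/-- The topological monoid `S` is left non-archimedean (l-NA): its left action on itself,
`s • t = s * t`, is non-archimedean. -/
def IsLeftNonarchimedean (S : Type u) [Monoid S] [TopologicalSpace S] [ContinuousMul S] : Prop :=
  IsNonarchimedeanAction.{u, v, u} S S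

/-- The Cantor set `2^ω`, with the product topology. -/
abbrev CantorCube : Type := ℕ → Bool

/-! Everything rests on one construction. Let a monoid `S` act from the right on a countable set
`I`, in such a way that `s ↦ i · s` is locally constant for every `i`. Then `S` acts continuously on
the left on `2 ^ I` by `(s χ) i = χ (i · s)`. Placing `I` inside `ℕ`, and letting `S` act trivially on
the complement, turns this into a continuous homomorphism `S → C(2^ω, 2^ω)`, and `2 ^ I` into an
equivariantly embedded subspace of `2^ω` (`exists_continuous_hom_of_rightAction`). As the
identity of `S` acts trivially on `ℕ`, it is sent to the identity map of `2^ω`; extending selfmaps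
along a retraction of `2^ω` onto a closed subspace would not achieve this.

* For a compact space `Y`, the monoid `C(Y, Y)` acts from the right on the clopen sets by preimage,
  and this action is locally constant. If `Y` is a metrizable Stone space, there are only countably
  many clopen sets, and `y ↦ {U | y ∈ U}` is an equivariant embedding of `Y` into `2^ω`.
  Since postcomposition with an embedding is an embedding for the compact-open topology, so is the
  resulting homomorphism on `C(Y, Y)`.
* A second countable monoid `S` acts from the right on its subsets by `A · s = {t | s * t ∈ A}`.
  If the topology of `S` has a countable subbasis of clopen sets whose translates `A · s` depend locally
  constantly on `s`, then there are only countably many such translates, and the construction gives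
  an embedding `h : S → C(2^ω, 2^ω)` together with an embedding `ν : S → 2^ω` such that
  `ν (s * t) = h s (ν t)` (`exists_embedding_of_translates`).
  In an l-NA monoid, the traces of the clopen sets of a Stone compactification form such a
  family. In `C(2^ω, 2^ω)` the sets `{f | f(K) ⊆ U}` with `K` and `U` clopen do, and the closure
  of the range of `ν` is then a Stone compactification showing that this monoid is l-NA. -/

/-! ### Right actions on countable sets -/

/-- A right action `φ` of `S` on a countable set `I`, locally constant in the acting element, yields a
continuous left action on `2 ^ I` by precomposition; `e` embeds `2 ^ I` equivariantly into the Cantor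
set. -/
theorem exists_continuous_hom_of_rightAction {S : Type u} [Monoid S] [TopologicalSpace S]
    {I : Type v} [Countable I] (φ : S → I → I) (h_one : ∀ i, φ 1 i = i)
    (h_mul : ∀ s t i, φ (s * t) i = φ t (φ s i))
    (h_const : ∀ i, IsLocallyConstant fun s => φ s i) :
    ∃ (h : S →* SelfMaps CantorCube) (e : (I → Bool) → CantorCube),
      Continuous h ∧ IsEmbedding e ∧ ∀ s χ, e (χ ∘ φ s) = h s • e χ := by
  classical
  obtain ⟨f, hf⟩ := exists_injective_nat I
  -- the right action on `ℕ`, trivial outside the range of `f`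
  let ψ : S → ℕ → ℕ := fun s => Function.extend f (f ∘ φ s) id
  have ψ_mem : ∀ s i, ψ s (f i) = f (φ s i) := fun s i => hf.extend_apply _ _ _
  have ψ_not_mem : ∀ s n, (¬ ∃ i, f i = n) → ψ s n = n := fun s n hn =>
    Function.extend_apply' _ _ _ hn
  have ψ_const : ∀ n, IsLocallyConstant fun s => ψ s n := by
    intro n
    by_cases hn : ∃ i, f i = n
    · obtain ⟨i, rfl⟩ := hn
      simp only [ψ_mem]
      exact (h_const i).comp f
    · simp only [ψ_not_mem _ n hn]
      exact IsLocallyConstant.const n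
  let h : S →* SelfMaps CantorCube :=
    { toFun := fun s => ⟨fun χ => χ ∘ ψ s, by fun_prop⟩
      map_one' := by
        refine ContinuousMap.ext fun χ => funext fun n => congrArg χ ?_
        by_cases hn : ∃ i, f i = n
        · obtain ⟨i, rfl⟩ := hn
          rw [ψ_mem, h_one]
        · exact ψ_not_mem _ n hn
      map_mul' := by
        intro s t
        refine ContinuousMap.ext fun χ => funext fun n => congrArg χ ?_
        by_cases hn : ∃ i, f i = n
        · obtain ⟨i, rfl⟩ := hn
          rw [ψ_mem, h_mul, ψ_mem, ψ_mem]
        · rw [ψ_not_mem _ n hn, ψ_not_mem s n hn, ψ_not_mem _ n hn] }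
  refine ⟨h, fun χ => Function.extend f χ fun _ => false, ?_, ?_, ?_⟩
  · refine ContinuousMap.continuous_of_continuous_uncurry (Y := CantorCube) (Z := CantorCube) h ?_
    refine continuous_pi fun n => continuous_iff_continuousAt.2 fun p => ?_
    have h_ev : (fun q : S × CantorCube => q.2 (ψ p.1 n)) =ᶠ[𝓝 p]
        fun q => q.2 (ψ q.1 n) := by
      filter_upwards [continuous_fst.continuousAt.eventually
        ((IsLocallyConstant.iff_eventually_eq _).1 (ψ_const n) p.1)] with q hq
      rw [hq]
    exact ((continuous_apply (ψ p.1 n)).comp continuous_snd).continuousAt.congr h_ev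
  · refine IsEmbedding.of_leftInverse (f := fun χ : CantorCube => χ ∘ f)
      (fun χ => funext fun i => hf.extend_apply _ _ _) (by fun_prop) (continuous_pi fun n => ?_)
    by_cases hn : ∃ i, f i = n
    · obtain ⟨i, rfl⟩ := hn
      simpa only [hf.extend_apply] using continuous_apply i
    · simpa only [Function.extend_apply' _ _ _ hn] using continuous_const
  · intro s χ
    funext n
    change Function.extend f (χ ∘ φ s) (fun _ => false) n =
      Function.extend f χ (fun _ => false) (ψ s n)
    by_cases hn : ∃ i, f i = n
    · obtain ⟨i, rfl⟩ := hn
      rw [ψ_mem, hf.extend_apply, hf.extend_apply, Function.comp_apply]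
    · rw [ψ_not_mem s n hn, Function.extend_apply' _ _ _ hn, Function.extend_apply' _ _ _ hn]

/-! ### Preimages of clopen sets under selfmaps -/

namespace SelfMaps

/-- The right action of `C(Y, Y)` on the clopen subsets of `Y` by preimage. -/
def clopenPreimage {Y : Type u} [TopologicalSpace Y] (f : SelfMaps Y) (U : Clopens Y) :
    Clopens Y :=
  ⟨{y | f • y ∈ U}, U.isClopen.preimage (ContinuousMap.continuous f)⟩

instance {Y : Type u} [TopologicalSpace Y] [LocallyCompactPair Y Y] :
    ContinuousSMul (SelfMaps Y) Y where
  continuous_smul := continuous_eval (F := C(Y, Y))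

theorem isLocallyConstant_clopenPreimage {Y : Type u} [TopologicalSpace Y] [CompactSpace Y]
    (U : Clopens Y) : IsLocallyConstant fun f : SelfMaps Y => clopenPreimage f U := by
  refine (IsLocallyConstant.iff_eventually_eq _).2 fun f => ?_
  -- near `f`, a map sends `f⁻¹ U` into `U` and the complement of `f⁻¹ U` into that of `U`
  have h_in := ContinuousMap.eventually_mapsTo (f := (f : C(Y, Y)))
    (clopenPreimage f U).isClopen.isClosed.isCompact U.isClopen.isOpen fun y hy => hy
  have h_out := ContinuousMap.eventually_mapsTo (f := (f : C(Y, Y)))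
    (clopenPreimage f U).isClopen.compl.isClosed.isCompact U.isClopen.compl.isOpen fun y hy => hy
  filter_upwards [h_in, h_out] with g hg hg'
  refine SetLike.ext fun y => ⟨fun hy => ?_, fun hy => hg hy⟩
  by_contra h_not
  exact hg' h_not hy

end SelfMaps

namespace IsStoneSpace

theorem of_totallyDisconnected (Y : Type u) [TopologicalSpace Y] [CompactSpace Y] [T2Space Y]
    [TotallyDisconnectedSpace Y] : IsStoneSpace Y :=
  ⟨inferInstance, inferInstance, isTopologicalBasis_isClopen⟩

theorem totallyDisconnectedSpace {Y : Type u} [TopologicalSpace Y] (hY : IsStoneSpace Y) :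
    TotallyDisconnectedSpace Y := by
  have := hY.t2
  have := totallySeparatedSpace_of_t0_of_basis_clopen hY.clopen_basis
  infer_instance

theorem countable_clopens {Y : Type u} [TopologicalSpace Y] [MetrizableSpace Y]
    (hY : IsStoneSpace Y) : Countable (Clopens Y) := by
  have := hY.compact
  have := hY.totallyDisconnectedSpace
  let := metrizableSpaceMetric Y
  exact Clopens.countable_iff_secondCountable.2 inferInstance

end IsStoneSpace

open Classical in
/-- A subbasis of clopen sets embeds a `T₀` space into a power of `Bool`. -/
theorem isEmbedding_decide_mem {X : Type u} [T : TopologicalSpace X] [T0Space X] {I : Type v}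
    (A : I → Set X) (hA : ∀ i, IsClopen (A i)) (h_gen : generateFrom (Set.range A) ≤ T) :
    IsEmbedding fun (x : X) (i : I) => decide (x ∈ A i) := by
  have h_cont : Continuous fun (x : X) (i : I) => decide (x ∈ A i) :=
    continuous_pi fun i => (continuous_bool_rng true).2 (by simpa [Set.preimage] using hA i)
  refine IsInducing.isEmbedding ⟨le_antisymm h_cont.le_induced (le_trans ?_ h_gen)⟩
  refine le_generateFrom ?_
  rintro _ ⟨i, rfl⟩
  refine isOpen_induced_iff.2 ⟨{χ | χ i = true},
    (isOpen_discrete {true}).preimage (continuous_apply (A := fun _ : I => Bool) i), ?_⟩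
  ext x
  simp

/-! ### Actions on metrizable Stone spaces -/

theorem exists_embedding_selfMaps_of_isStoneSpace (Y : Type w) [TopologicalSpace Y]
    [MetrizableSpace Y] (hY : IsStoneSpace Y) :
    ∃ (h : SelfMaps Y →* SelfMaps CantorCube) (α : Y → CantorCube),
      IsEmbedding h ∧ IsEmbedding α ∧ ∀ (s : SelfMaps Y) (y : Y), α (s • y) = h s • α y := by
  classical
  have := hY.compact
  have := hY.t2
  have := hY.countable_clopens
  obtain ⟨h, e, h_cont, he, h_equiv⟩ := exists_continuous_hom_of_rightAction
    (S := SelfMaps Y) SelfMaps.clopenPreimage (fun _ => rfl) (fun _ _ _ => rfl)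
    SelfMaps.isLocallyConstant_clopenPreimage
  let χ : Y → Clopens Y → Bool := fun y U => decide (y ∈ (U : Set Y))
  have hχ : IsEmbedding χ := by
    refine isEmbedding_decide_mem _ (fun U : Clopens Y => U.isClopen) ?_
    exact le_trans (generateFrom_anti fun U hU => Set.mem_range.2 ⟨⟨U, hU⟩, rfl⟩)
      hY.clopen_basis.eq_generateFrom.ge
  have hα : IsEmbedding (e ∘ χ) := he.comp hχ
  have h_act : ∀ (s : SelfMaps Y) (y : Y), e (χ (s • y)) = h s • e (χ y) :=
    fun s y => h_equiv s (χ y)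
  refine ⟨h, e ∘ χ, ?_, hα, h_act⟩
  let α : C(Y, CantorCube) := ⟨e ∘ χ, hα.continuous⟩
  -- `h` followed by restriction to the image of `Y` is postcomposition with `α`
  refine IsEmbedding.of_comp h_cont (g := fun g : C(CantorCube, CantorCube) => g.comp α)
    (ContinuousMap.continuous_precomp α) ?_
  have h_eq : (fun g : C(CantorCube, CantorCube) => g.comp α) ∘ h =
      fun s : C(Y, Y) => α.comp s :=
    funext fun s => ContinuousMap.ext fun y => (h_act s y).symm
  rw [h_eq]
  exact ContinuousMap.isEmbedding_postcomp α hα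

/-! ### Monoids acting on their subsets -/

/-- If `C` is a countable subbasis of clopen sets and the translates `{t | s * t ∈ A}` of its members
depend locally constantly on `s`, then `S` embeds into `C(2^ω, 2^ω)` and the left action of `S` on
itself embeds equivariantly into `2^ω`. -/
theorem exists_embedding_of_translates {S : Type u} [Monoid S] [T : TopologicalSpace S]
    [ContinuousMul S] [T0Space S] [SeparableSpace S] (C : Set (Set S)) (hC : C.Countable)
    (h_clopen : ∀ A ∈ C, IsClopen A) (h_gen : generateFrom C ≤ T)
    (h_const : ∀ A ∈ C, IsLocallyConstant fun s : S => {t : S | s * t ∈ A}) :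
    ∃ (h : S →* SelfMaps CantorCube) (ν : S → CantorCube),
      IsEmbedding h ∧ IsEmbedding ν ∧ ∀ s t : S, ν (s * t) = h s • ν t := by
  classical
  let D : Set (Set S) := ⋃ A ∈ C, Set.range fun s : S => {t : S | s * t ∈ A}
  have mem_D : ∀ {B : Set S}, B ∈ D ↔ ∃ A ∈ C, ∃ s : S, {t : S | s * t ∈ A} = B := by
    simp [D]
  -- a locally constant function on a separable space has countable range
  have hD : D.Countable := by
    refine hC.biUnion fun A hA => ?_
    obtain ⟨Q, hQ, hQ_dense⟩ := exists_countable_dense S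
    refine (hQ.image fun s : S => {t : S | s * t ∈ A}).mono ?_
    rintro _ ⟨s, rfl⟩
    obtain ⟨q, hq, hqQ⟩ := hQ_dense.inter_open_nonempty _
      ((h_const A hA).isOpen_fiber {t : S | s * t ∈ A}) ⟨s, rfl⟩
    exact ⟨q, hqQ, hq⟩
  have : Countable D := hD.to_subtype
  have D_translate : ∀ (s : S), ∀ B ∈ D, {t : S | s * t ∈ B} ∈ D := by
    intro s B hB
    obtain ⟨A, hA, u, rfl⟩ := mem_D.1 hB
    exact mem_D.2 ⟨A, hA, u * s, by simp [mul_assoc]⟩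
  have D_clopen : ∀ B : D, IsClopen (B : Set S) := by
    rintro ⟨B, hB⟩
    obtain ⟨A, hA, u, rfl⟩ := mem_D.1 hB
    exact (h_clopen A hA).preimage (continuous_const_mul u)
  have D_const : ∀ B ∈ D, IsLocallyConstant fun s : S => {t : S | s * t ∈ B} := by
    intro B hB
    obtain ⟨A, hA, u, rfl⟩ := mem_D.1 hB
    have := (h_const A hA).comp_continuous (continuous_const_mul u)
    simpa [Function.comp_def, mul_assoc] using this
  obtain ⟨h, e, h_cont, he, h_equiv⟩ := exists_continuous_hom_of_rightAction
    (S := S) (I := D) (fun s B => ⟨{t : S | s * t ∈ B.1}, D_translate s B.1 B.2⟩)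
    (fun B => by simp) (fun s t B => by simp [mul_assoc])
    (fun B => IsLocallyConstant.desc _ Subtype.val (D_const B.1 B.2) Subtype.val_injective)
  let χ : S → D → Bool := fun t B => decide (t ∈ B.1)
  have hχ : IsEmbedding χ := by
    refine isEmbedding_decide_mem (fun B : D => (B : Set S)) D_clopen
      ((generateFrom_anti fun A hA => ?_).trans h_gen)
    exact ⟨⟨A, mem_D.2 ⟨A, hA, 1, by simp⟩⟩, rfl⟩
  have hν : IsEmbedding (e ∘ χ) := he.comp hχ
  have h_act : ∀ s t : S, e (χ (s * t)) = h s • e (χ t) := fun s t => h_equiv s (χ t)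
  refine ⟨h, e ∘ χ, ?_, hν, h_act⟩
  -- `h` followed by evaluation at the image of `1` is `e ∘ χ`
  refine IsEmbedding.of_comp h_cont (g := fun g : SelfMaps CantorCube => g • e (χ 1))
    (by fun_prop) ?_
  have h_eq : (fun g : SelfMaps CantorCube => g • e (χ 1)) ∘ h = e ∘ χ :=
    funext fun s => by simp [← h_act]
  rwa [h_eq]

/-- In a monoid with a compactification by a Stone `S`-space, the translates of the traces of
clopen sets are the traces of their preimages under the action. -/
theorem exists_embedding_of_isLeftNonarchimedean (S : Type u) [Monoid S] [TopologicalSpace S]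
    [ContinuousMul S] [SeparableSpace S] [MetrizableSpace S]
    (hS : IsLeftNonarchimedean.{u, v} S) :
    ∃ h : S →* SelfMaps CantorCube, IsEmbedding h := by
  obtain ⟨Y, _, _, ν, hY, _, hν, -, h_equiv⟩ := hS
  have := hY.compact
  let := metrizableSpaceMetric S
  have : SecondCountableTopology S := UniformSpace.secondCountable_of_separable S
  obtain ⟨C, hC_sub, hC, hC_basis⟩ := (hY.clopen_basis.isInducing hν.isInducing).exists_countable
  have h_trace : ∀ A ∈ C, ∃ U : Clopens Y, ν ⁻¹' U = A := fun A hA => by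
    obtain ⟨U, hU, rfl⟩ := hC_sub hA
    exact ⟨⟨U, hU⟩, rfl⟩
  let ρ : S → SelfMaps Y := fun s => ⟨fun y => s • y, continuous_const_smul s⟩
  have hρ : Continuous ρ := ContinuousMap.continuous_of_continuous_uncurry
    (Y := Y) (Z := Y) ρ continuous_smul
  obtain ⟨h, -, hh, -⟩ := exists_embedding_of_translates C hC
    (fun A hA => by
      obtain ⟨U, rfl⟩ := h_trace A hA
      exact U.isClopen.preimage hν.continuous)
    hC_basis.eq_generateFrom.ge
    (fun A hA => by
      obtain ⟨U, rfl⟩ := h_trace A hA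
      have h_const := ((SelfMaps.isLocallyConstant_clopenPreimage U).comp_continuous hρ).comp
        fun V : Clopens Y => ν ⁻¹' (V : Set Y)
      have h_eq : (fun s : S => {t : S | s * t ∈ ν ⁻¹' (U : Set Y)}) =
          (fun V : Clopens Y => ν ⁻¹' (V : Set Y)) ∘ (fun f => SelfMaps.clopenPreimage f U) ∘ ρ := by
        funext s
        ext t
        change ν (s • t) ∈ U ↔ s • ν t ∈ U
        rw [h_equiv]
      rw [h_eq]
      exact h_const)
  exact ⟨h, hh⟩

/-! ### The monoid of selfmaps of the Cantor set -/

namespace SelfMaps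

instance {Y : Type u} [TopologicalSpace Y] [CompactSpace Y] [MetrizableSpace Y] :
    PolishSpace (SelfMaps Y) := by
  let := metrizableSpaceMetric Y
  exact inferInstanceAs (PolishSpace C(Y, Y))

/-- On a Stone space, the compact-open topology is generated by the sets of maps sending one
clopen set into another. -/
theorem generateFrom_mapsTo_clopens_le {Y : Type u} [TopologicalSpace Y] (hY : IsStoneSpace Y) :
    generateFrom (Set.range fun p : Clopens Y × Clopens Y =>
      {f : SelfMaps Y | p.1 ≤ clopenPreimage f p.2}) ≤
        (inferInstance : TopologicalSpace (SelfMaps Y)) := by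
  have := hY.compact
  have := hY.t2
  have := hY.totallyDisconnectedSpace
  refine le_trans ?_ (ContinuousMap.compactOpen_eq (X := Y) (Y := Y)).ge
  refine le_generateFrom ?_
  rintro _ ⟨K, hK, U, hU, rfl⟩
  refine (@isOpen_iff_forall_mem_open _ (generateFrom _) _).2 fun f hf => ?_
  obtain ⟨V, hV, hKV, hVU⟩ := exists_clopen_of_closed_subset_open
    (hK.image (ContinuousMap.continuous f)).isClosed hU (Set.image_subset_iff.2 hf)
  let W : Clopens Y := ⟨V, hV⟩
  exact ⟨{g | clopenPreimage f W ≤ clopenPreimage g W}, fun g hg y hy => hVU (hg (hKV ⟨y, hy, rfl⟩)),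
    isOpen_generateFrom_of_mem ⟨(clopenPreimage f W, W), rfl⟩, le_refl (clopenPreimage f W)⟩

theorem isClopen_le_clopenPreimage {Y : Type u} [TopologicalSpace Y] [CompactSpace Y]
    (K U : Clopens Y) : IsClopen {f : SelfMaps Y | K ≤ clopenPreimage f U} :=
  ContinuousMap.isClopen_setOfPred_mapsTo K.isClopen.isClosed.isCompact U.isClopen

theorem isLocallyConstant_le_clopenPreimage_mul {Y : Type u} [TopologicalSpace Y] [CompactSpace Y]
    (K U : Clopens Y) : IsLocallyConstant fun s : SelfMaps Y =>
      {t : SelfMaps Y | s * t ∈ {f : SelfMaps Y | K ≤ clopenPreimage f U}} :=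
  -- `K ⊆ (s * t)⁻¹ U` depends on `s` only through `s⁻¹ U`
  (isLocallyConstant_clopenPreimage U).comp
    fun V => {t : SelfMaps Y | K ≤ clopenPreimage t V}

theorem isLeftNonarchimedean_cantorCube :
    IsLeftNonarchimedean.{0, 0} (SelfMaps CantorCube) := by
  have h_stone := IsStoneSpace.of_totallyDisconnected CantorCube
  have := h_stone.countable_clopens
  obtain ⟨h, ν, hh, hν, h_equiv⟩ := exists_embedding_of_translates (S := SelfMaps CantorCube)
    _ (Set.countable_range _)
    (by rintro _ ⟨p, rfl⟩; exact isClopen_le_clopenPreimage p.1 p.2)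
    (generateFrom_mapsTo_clopens_le h_stone)
    (by rintro _ ⟨p, rfl⟩; exact isLocallyConstant_le_clopenPreimage_mul p.1 p.2)
  -- the compactification is the closure of the range of `ν`, on which `s` acts as `h s`
  let Z : Set CantorCube := closure (Set.range ν)
  have hZ : ∀ s, ∀ z ∈ Z, h s • z ∈ Z := fun s z hz =>
    map_mem_closure (continuous_const_smul (h s)) hz <| by
      rintro _ ⟨t, rfl⟩
      exact ⟨s * t, h_equiv s t⟩
  let : MulAction (SelfMaps CantorCube) Z :=
    { smul := fun s z => ⟨h s • z.1, hZ s z.1 z.2⟩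
      one_smul := fun z => Subtype.ext (by change h 1 • z.1 = z.1; simp)
      mul_smul := fun s t z => Subtype.ext (by
        change h (s * t) • z.1 = h s • h t • z.1
        rw [map_mul, mul_smul]) }
  have : CompactSpace Z := isCompact_iff_compactSpace.1 isClosed_closure.isCompact
  refine ⟨Z, inferInstance, inferInstance, fun t => ⟨ν t, subset_closure ⟨t, rfl⟩⟩,
    IsStoneSpace.of_totallyDisconnected Z, ⟨?_⟩, hν.codRestrict Z _, ?_,
    fun s t => Subtype.ext (h_equiv s t)⟩
  · exact Continuous.subtype_mk ((hh.continuous.comp continuous_fst).smul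
      (continuous_subtype_val.comp continuous_snd)) _
  · intro z
    rw [closure_subtype, ← Set.range_comp]
    exact z.2

end SelfMaps

theorem theorem5 :
    -- `C(2^ω, 2^ω)` is itself a Polish l-NA topological monoid
    (PolishSpace (SelfMaps CantorCube) ∧ IsLeftNonarchimedean.{0, 0} (SelfMaps CantorCube)) ∧
    -- every separable metrizable l-NA monoid embeds into it
    (∀ (S : Type u) [Monoid S] [TopologicalSpace S] [ContinuousMul S]
        [SeparableSpace S] [MetrizableSpace S],
      IsLeftNonarchimedean.{u, v} S →
        ∃ h : S →* SelfMaps CantorCube, IsEmbedding h) ∧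
    -- its action on `2^ω` is a continuous action on a metrizable Stone space
    (IsStoneSpace CantorCube ∧ MetrizableSpace CantorCube ∧
      ContinuousSMul (SelfMaps CantorCube) CantorCube) ∧
    -- every action of a submonoid of `C(Y, Y)`, `Y` a metrizable Stone space, embeds into it
    (∀ (Y : Type w) [TopologicalSpace Y] [MetrizableSpace Y], IsStoneSpace Y →
      ∀ S : Submonoid (SelfMaps Y),
        ∃ (h : S →* SelfMaps CantorCube) (α : Y → CantorCube),
          IsEmbedding h ∧ IsEmbedding α ∧ ∀ (s : S) (y : Y), α (s • y) = h s • α y) := by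
  refine ⟨⟨inferInstance, SelfMaps.isLeftNonarchimedean_cantorCube⟩,
    fun S _ _ _ _ _ hS => exists_embedding_of_isLeftNonarchimedean S hS,
    ⟨IsStoneSpace.of_totallyDisconnected _, inferInstance, inferInstance⟩, fun Y _ _ hY S => ?_⟩
  obtain ⟨h, α, hh, hα, h_equiv⟩ := exists_embedding_selfMaps_of_isStoneSpace Y hY
  exact ⟨h.comp S.subtype, α, hh.comp IsEmbedding.subtypeVal, hα, fun s y => h_equiv s y⟩
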